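/- Let $M$ be a structure in a first-order language $L$. A subset $B\subseteq M^n$ is *mutually algebraic* if there is $K\in\mathbb N$ such that for every partition $\{1,\dots,n\}=X\sqcup Y$ into non-empty parts, the projection of $B$ to the coordinates in $Y$ is at most $K$-to-one. An $L(M)$-formula $\varphi(\bar z)$ (that is, with parameters from $M$) is mutually algebraic if its solution set in $M^{\lg(\bar z)}$ is, and $\mathcal{MA}^*(M)$ is the set of all $L(M)$-formulas that are equivalent, modulo the elementary diagram $Th(M_M)$, to a boolean combination of mutually algebraic $L(M)$-formulas, where different formulas in the combination may involve different subtuples of the variables. The *mutually algebraic reduct* of $M$ is the structure with the same universe as $M$ whose definable sets are precisely the sets defined by formulas in $\mathcal{MA}^*(M)$; it is determined up to the choice of its language. A theory $T$ has the *non-finite cover property (nfcp)* if for every partitioned formula $\varphi(\bar x,\bar y)$ of its language there is a number $k$ such that for every model $N$ of $T$ and every set $C$ of tuples $\bar c\in N^{\lg(\bar y)}$, the set $\{\varphi(\bar x,\bar c):\bar c\in C\}$ is consistent (realized in some elementary extension of $N$) whenever $\{\varphi(\bar x,\bar c):\bar c\in D\}$ is consistent for every $D\subseteq C$ with at most $k$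 elements. **Proposition.** For any structure $M$, the mutually algebraic reduct of $M$ exists (it can be presented by taking the universe of $M$ with one $n$-ary relation symbol for each formula in $\mathcal{MA}^*(M)$ in $n$ variables, interpreted as its solution set), and the theory of the mutually algebraic reduct of $M$, in any presentation of it, has nfcp. -/

import Mathlib

universe u v w u' v' w'

open FirstOrder FirstOrder.Language

/-- `B ⊆ Aⁿ` is mutually algebraic if there is `K` such that for every partition of the coordinates
into two non-empty parts `Y` and `Yᶜ`, the projection to the coordinates in `Y`, restricted to `B`,
is at most `K`-to-one. -/
def IsMutuallyAlgebraicSet {A : Type w} {n : ℕ} (B : Set (Fin n → A)) : Prop :=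
  ∃ K : ℕ, ∀ Y : Set (Fin n), Y.Nonempty → Yᶜ.Nonempty →
    ∀ b ∈ B, {a ∈ B | ∀ i ∈ Y, a i = b i}.encard ≤ K

namespace FirstOrder.Language

section MutuallyAlgebraic

variable (L : Language.{u, v}) (M : Type w) [L.Structure M]

/-- An `L(M)`-formula `φ(z₁, …, zₙ)` is mutually algebraic if its solution set in `Mⁿ` is.
The displayed variables matter: this is not invariant under adding dummy variables. -/
def IsMAFormula {n : ℕ} (φ : L[[M]].Formula (Fin n)) : Prop :=
  IsMutuallyAlgebraicSet {a : Fin n → M | φ.Realize a}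

/-- Boolean combinations, in the variables `z₁, …, zₙ`, of mutually algebraic `L(M)`-formulas
`φ(z_{f 1}, …, z_{f k})`, each of them in its own tuple of distinct variables. -/
inductive IsBoolCombMA {n : ℕ} : L[[M]].Formula (Fin n) → Prop
  | of {k : ℕ} (φ : L[[M]].Formula (Fin k)) (hφ : IsMAFormula L M φ) (f : Fin k ↪ Fin n) :
      IsBoolCombMA (Formula.relabel f φ)
  | bot : IsBoolCombMA ⊥
  | not {φ : L[[M]].Formula (Fin n)} (hφ : IsBoolCombMA φ) : IsBoolCombMA (Formula.not φ)
  | inf {φ ψ : L[[M]].Formula (Fin n)} (hφ : IsBoolCombMA φ) (hψ : IsBoolCombMA ψ) :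
      IsBoolCombMA (φ ⊓ ψ)

/-- The class `MA*(M)`: the `L(M)`-formulas that are equivalent, modulo the elementary diagram
`Th(M_M)`, to a boolean combination of mutually algebraic `L(M)`-formulas. -/
def IsMAStar {n : ℕ} (φ : L[[M]].Formula (Fin n)) : Prop :=
  ∃ ψ : L[[M]].Formula (Fin n), IsBoolCombMA L M ψ ∧ φ ⇔[L.elementaryDiagram M] ψ

/-- An `L'`-structure on the universe of the `L`-structure `M` is (a presentation of) the mutually
algebraic reduct of `M_M` if its definable sets are exactly the sets defined in `M` by the formulas
in `MA*(M)`. -/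
def IsMAReduct (L' : Language.{u', v'}) [L'.Structure M] : Prop :=
  ∀ (n : ℕ) (S : Set (Fin n → M)),
    (∅ : Set M).Definable L' S ↔
      ∃ φ : L[[M]].Formula (Fin n), IsMAStar L M φ ∧ S = {a | φ.Realize a}

/-- The relational language with one `n`-ary relation symbol for each formula in `MA*(M)` in `n`
variables. -/
def maLanguage : Language.{0, max u v w} where
  Functions := fun _ => Empty
  Relations := fun n => {φ : L[[M]].Formula (Fin n) // IsMAStar L M φ}

/-- The structure with the universe of `M` in which the symbol of `φ` is interpreted as the
solution set of `φ` in `M`. -/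
instance maStructure : (maLanguage L M).Structure M where
  funMap := fun f => Empty.elim f
  RelMap := fun R a => Formula.Realize R.1 a

end MutuallyAlgebraic

/-- The set of formulas `{φ(x̄, c) : c ∈ C}` over a structure `N` is consistent (with the elementary
diagram of `N`): some tuple in some elementary extension of `N` realizes all of them. -/
def InstancesConsistent {L : Language.{u, v}} {N : Type w} [L.Structure N] {m n : ℕ}
    (φ : L.Formula (Fin m ⊕ Fin n)) (C : Set (Fin n → N)) : Prop :=
  ∃ (N' : Type (max u v w)) (_ : L.Structure N') (f : N ↪ₑ[L] N') (a : Fin m → N'),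
    ∀ c ∈ C, φ.Realize (Sum.elim a (f ∘ c))

/-- The partitioned formula `φ(x̄, ȳ)` does not have the finite cover property with respect to `T`:
there is `k` such that any set of instances of `φ` over a model of `T` is consistent as soon as
each of its subsets with at most `k` elements is. -/
def Theory.FormulaNFCP {L : Language.{u, v}} (T : L.Theory) {m n : ℕ}
    (φ : L.Formula (Fin m ⊕ Fin n)) : Prop :=
  ∃ k : ℕ, ∀ (N : Type w') [L.Structure N] [N ⊨ T] (C : Set (Fin n → N)),
    (∀ D : Finset (Fin n → N), (D : Set (Fin n → N)) ⊆ C → D.card ≤ k →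
      InstancesConsistent φ (D : Set (Fin n → N))) →
    InstancesConsistent φ C

/-- `T` has the non-finite cover property: no partitioned formula has the finite cover property
with respect to `T`. (The universe `w'` is the one in which the models of `T` are taken.) -/
def Theory.HasNFCP {L : Language.{u, v}} (T : L.Theory) : Prop :=
  ∀ (m n : ℕ) (φ : L.Formula (Fin m ⊕ Fin n)), Theory.FormulaNFCP.{u, v, w'} T φ

end FirstOrder.Language

-- Work semantically: call a set a combination if membership in finitely many cylinders over
-- mutually algebraic definable sets decides it. For existence of the reduct, the point is that
-- combinations are closed under projection (`IsMACombination.exists_update`). In a fixed direction,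
-- a mutually algebraic cylinder either ignores the coordinate, depends on it alone, or has fibres
-- of bounded size. An atom of the boolean algebra that lies in a cylinder of the third kind has
-- bounded fibres, whose exact size is again expressed by combinations. Any other atom has as fibre,
-- if nonempty, a set `V` not depending on the point with finitely many elements removed.
--
-- The same trichotomy gives nfcp. Fibres of a combination in one coordinate are constant on
-- finitely many cells of `M`, up to exceptional sets of bounded size, so families of fibres have a
-- finite Helly number (`IsMACombination.exists_helly_coord`). Projection closure extends this to
-- several coordinates by induction (`IsMACombination.exists_helly`). The Helly property of a
-- formula is a scheme of first-order sentences, so it passes to every model of the theory;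
-- compactness then handles infinite families.

namespace FirstOrder.Language

-- Mutually algebraic cylinders and the closure properties of their combinations.

section Combinatorics

variable (L : Language.{u, v}) {M : Type w} [L.Structure M] {α : Type u'} {β : Type v'}

/-- Definability in `M` by a formula with parameters from `M`. -/
abbrev ParamDefinable (S : Set (α → M)) : Prop :=
  (∅ : Set M).Definable L[[M]] S

/-- On `S`, the coordinate `i` determines the coordinate `j` up to boundedly many choices. -/
def BoundsCoord (S : Set (α → M)) (i j : α) : Prop :=
  ∃ K : ℕ, ∀ m, ((fun a : α → M => a j) '' {a ∈ S | a i = m}).encard ≤ K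

/-- The cylinder `S` is definable with parameters, depends only on the coordinates in `s`, and is
mutually algebraic as a set of tuples indexed by `s`. -/
structure IsMAOn (S : Set (α → M)) (s : Set α) : Prop where
  definable : ParamDefinable L S
  congr : ∀ a b, Set.EqOn a b s → a ∈ S → b ∈ S
  bounds : ∀ i ∈ s, ∀ j ∈ s, BoundsCoord S i j

/-- The sets determined by membership in finitely many cylinders over mutually algebraic
definable sets. -/
def IsMACombination (S : Set (α → M)) : Prop :=
  ∃ F : Set (Set (α → M)), F.Finite ∧ (∀ G ∈ F, ∃ s, IsMAOn L G s) ∧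
    ∀ a b, (∀ G ∈ F, a ∈ G ↔ b ∈ G) → a ∈ S → b ∈ S

variable {L}

theorem paramDefinable_iff {S : Set (α → M)} :
    ParamDefinable L S ↔ ∃ φ : L[[M]].Formula α, S = {a | φ.Realize a} :=
  Set.empty_definable_iff

/-- One substitution both renames variables and plugs in parameters; identification of variables,
dummy variables and specialization are all instances. -/
theorem ParamDefinable.subst {S : Set (α → M)} (hS : ParamDefinable L S) (g : α → β ⊕ M) :
    ParamDefinable L {b : β → M | (fun i => Sum.elim b id (g i)) ∈ S} := by
  rw [paramDefinable_iff] at hS ⊢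
  obtain ⟨φ, rfl⟩ := hS
  refine ⟨BoundedFormula.subst φ
    (fun i => Sum.elim Term.var (fun m => (L.con m).term) (g i)), ?_⟩
  ext b
  simp only [Set.mem_ofPred_eq, Formula.Realize, BoundedFormula.realize_subst]
  have : (fun i => Sum.elim b id (g i)) = fun i => Term.realize b
      (Sum.elim (Term.var : β → L[[M]].Term β) (fun m => (L.con m).term) (g i)) := by
    funext i
    cases g i with
    | inl j => simp
    | inr m => rfl
  rw [this]

theorem paramDefinable_eq (i j : α) : ParamDefinable L {a : α → M | a i = a j} := by
  rw [paramDefinable_iff]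
  exact ⟨(Term.var i).equal (Term.var j), by ext; simp⟩

theorem BoundsCoord.refl (S : Set (α → M)) (i : α) : BoundsCoord S i i := by
  refine ⟨1, fun m => ?_⟩
  rw [Nat.cast_one, Set.encard_le_one_iff]
  rintro _ _ ⟨a, ⟨-, rfl⟩, rfl⟩ ⟨b, ⟨-, hb⟩, rfl⟩
  exact hb.symm

theorem BoundsCoord.mono {S T : Set (α → M)} {i j : α} (h : BoundsCoord T i j) (hST : S ⊆ T) :
    BoundsCoord S i j := by
  obtain ⟨K, hK⟩ := h
  exact ⟨K, fun m => le_trans (Set.encard_le_encard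
    (Set.image_mono (Set.inter_subset_inter_left _ hST))) (hK m)⟩

theorem encard_biUnion_le {ι X : Type*} {A : Set ι} {f : ι → Set X} {K N : ℕ} (hA : A.encard ≤ K)
    (hf : ∀ i ∈ A, (f i).encard ≤ N) : (⋃ i ∈ A, f i).encard ≤ (K * N : ℕ) := by
  classical
  have hfin : A.Finite := Set.finite_of_encard_le_coe hA
  lift A to Finset ι using hfin
  rw [Set.encard_coe_eq_coe_finsetCard, Nat.cast_le] at hA
  have key : ∀ B : Finset ι, B ⊆ A → (⋃ i ∈ B, f i).encard ≤ (B.card * N : ℕ) := by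
    intro B
    induction B using Finset.induction_on with
    | empty => simp
    | insert i B hi ih =>
      intro hB
      rw [Finset.set_biUnion_insert, Finset.card_insert_of_notMem hi]
      refine (Set.encard_union_le _ _).trans ?_
      have h1 := hf i (hB (Finset.mem_insert_self i B))
      have h2 := ih fun x hx => hB (Finset.mem_insert_of_mem hx)
      calc _ ≤ (N : ℕ∞) + (B.card * N : ℕ) := add_le_add h1 h2
        _ = _ := by push_cast; ring
  refine (key A subset_rfl).trans ?_
  exact_mod_cast Nat.mul_le_mul_right N hA

theorem BoundsCoord.trans {S : Set (α → M)} {i j k : α} (h : BoundsCoord S i j)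
    (h' : BoundsCoord S j k) : BoundsCoord S i k := by
  obtain ⟨K, hK⟩ := h
  obtain ⟨N, hN⟩ := h'
  refine ⟨K * N, fun m => ?_⟩
  refine le_trans (Set.encard_le_encard ?_) (encard_biUnion_le (hK m) fun x _ => hN x)
  rintro _ ⟨a, ha, rfl⟩
  simp only [Set.mem_iUnion]
  exact ⟨a j, ⟨a, ha, rfl⟩, a, ⟨ha.1, rfl⟩, rfl⟩

/-- The shared coordinate `i` is essential: bounds between a coordinate of `s` and one of `t` are
obtained by passing through it. -/
theorem IsMAOn.inter {S T : Set (α → M)} {s t : Set α} (hS : IsMAOn L S s) (hT : IsMAOn L T t)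
    {i : α} (hs : i ∈ s) (ht : i ∈ t) : IsMAOn L (S ∩ T) (s ∪ t) where
  definable := hS.definable.inter hT.definable
  congr a b hab h := ⟨hS.congr a b (hab.mono Set.subset_union_left) h.1,
    hT.congr a b (hab.mono Set.subset_union_right) h.2⟩
  bounds := by
    have toI : ∀ j ∈ s ∪ t, BoundsCoord (S ∩ T) j i := fun j hj => hj.elim
      (fun hj => (hS.bounds j hj i hs).mono Set.inter_subset_left)
      (fun hj => (hT.bounds j hj i ht).mono Set.inter_subset_right)
    have ofI : ∀ j ∈ s ∪ t, BoundsCoord (S ∩ T) i j := fun j hj => hj.elim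
      (fun hj => (hS.bounds i hs j hj).mono Set.inter_subset_left)
      (fun hj => (hT.bounds i ht j hj).mono Set.inter_subset_right)
    exact fun j hj k hk => (toI j hj).trans (ofI k hk)

theorem IsMAOn.subst {S : Set (α → M)} {s : Set α} (hS : IsMAOn L S s) (g : α → β ⊕ M) :
    IsMAOn L {b : β → M | (fun i => Sum.elim b id (g i)) ∈ S}
      {j | ∃ i ∈ s, g i = Sum.inl j} where
  definable := hS.definable.subst g
  congr a b hab h := by
    refine hS.congr _ _ (fun i hi => ?_) h
    rcases hg : g i with j | m
    · exact hab ⟨i, hi, hg⟩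
    · rfl
  bounds := by
    rintro j ⟨i, hi, hij⟩ j' ⟨i', hi', hij'⟩
    obtain ⟨K, hK⟩ := hS.bounds i hi i' hi'
    refine ⟨K, fun m => le_trans (Set.encard_le_encard ?_) (hK m)⟩
    rintro _ ⟨b, ⟨hb, rfl⟩, rfl⟩
    exact ⟨_, ⟨hb, by simp [hij]⟩, by simp [hij']⟩

theorem IsMAOn.isMACombination {S : Set (α → M)} {s : Set α} (hS : IsMAOn L S s) :
    IsMACombination L S :=
  ⟨{S}, Set.finite_singleton S, by rintro _ rfl; exact ⟨s, hS⟩,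
    fun a b h ha => (h S rfl).1 ha⟩

namespace IsMACombination

theorem of_determined {F : Set (Set (α → M))} (hF : F.Finite)
    (h : ∀ G ∈ F, IsMACombination L G) {S : Set (α → M)}
    (hS : ∀ a b, (∀ G ∈ F, a ∈ G ↔ b ∈ G) → a ∈ S → b ∈ S) : IsMACombination L S := by
  choose! E hEf hEg hE using h
  refine ⟨⋃ G ∈ F, E G, hF.biUnion hEf, ?_, ?_⟩
  · intro G hG
    simp only [Set.mem_iUnion] at hG
    obtain ⟨T, hT, hG⟩ := hG
    exact hEg T hT G hG
  · intro a b hab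
    have hab' : ∀ G ∈ F, ∀ T ∈ E G, a ∈ T ↔ b ∈ T := fun G hG T hT =>
      hab T (Set.mem_biUnion hG hT)
    exact hS a b fun G hG => ⟨hE G hG a b (hab' G hG),
      hE G hG b a fun T hT => (hab' G hG T hT).symm⟩

theorem compl {S : Set (α → M)} (hS : IsMACombination L S) : IsMACombination L Sᶜ :=
  of_determined (Set.finite_singleton S) (by rintro _ rfl; exact hS)
    fun a b h ha hb => ha ((h S rfl).2 hb)

theorem inter {S T : Set (α → M)} (hS : IsMACombination L S) (hT : IsMACombination L T) :
    IsMACombination L (S ∩ T) :=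
  of_determined (F := {S, T}) (by simp) (by rintro _ (rfl | rfl); exacts [hS, hT])
    fun a b h ha => ⟨(h S (by simp)).1 ha.1, (h T (by simp)).1 ha.2⟩

theorem univ : IsMACombination L (Set.univ : Set (α → M)) :=
  of_determined (F := ∅) (by simp) (by simp) fun _ _ _ _ => trivial

theorem empty : IsMACombination L (∅ : Set (α → M)) := by
  simpa using (univ (L := L) (M := M) (α := α)).compl

theorem biUnion {ι : Type*} {A : Set ι} (hA : A.Finite) {f : ι → Set (α → M)}
    (h : ∀ i ∈ A, IsMACombination L (f i)) : IsMACombination L (⋃ i ∈ A, f i) := by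
  refine of_determined (F := f '' A) (hA.image f) (by rintro _ ⟨i, hi, rfl⟩; exact h i hi) ?_
  intro a b hab ha
  simp only [Set.mem_iUnion] at ha ⊢
  obtain ⟨i, hi, ha⟩ := ha
  exact ⟨i, hi, (hab _ ⟨i, hi, rfl⟩).1 ha⟩

theorem biInter {ι : Type*} {A : Set ι} (hA : A.Finite) {f : ι → Set (α → M)}
    (h : ∀ i ∈ A, IsMACombination L (f i)) : IsMACombination L (⋂ i ∈ A, f i) := by
  rw [← compl_compl (⋂ i ∈ A, f i)]
  simp only [Set.compl_iInter]
  exact (biUnion hA fun i hi => (h i hi).compl).compl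

theorem subst {S : Set (α → M)} (hS : IsMACombination L S) (g : α → β ⊕ M) :
    IsMACombination L {b : β → M | (fun i => Sum.elim b id (g i)) ∈ S} := by
  obtain ⟨F, hF, hFg, hFS⟩ := hS
  refine ⟨(fun G => {b : β → M | (fun i => Sum.elim b id (g i)) ∈ G}) '' F, hF.image _, ?_, ?_⟩
  · rintro _ ⟨G, hG, rfl⟩
    obtain ⟨s, hs⟩ := hFg G hG
    exact ⟨_, hs.subst g⟩
  · exact fun a b hab => hFS _ _ fun G hG => hab _ ⟨G, hG, rfl⟩

theorem preimage_comp {S : Set (α → M)} (hS : IsMACombination L S) (g : α → β) :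
    IsMACombination L {b : β → M | b ∘ g ∈ S} :=
  hS.subst fun i => Sum.inl (g i)

theorem eq (i j : α) : IsMACombination L {a : α → M | a i = a j} := by
  refine IsMAOn.isMACombination (s := {i, j}) ⟨paramDefinable_eq i j, ?_, ?_⟩
  · intro a b hab (ha : a i = a j)
    have hi := hab (by simp : i ∈ ({i, j} : Set α))
    have hj := hab (by simp : j ∈ ({i, j} : Set α))
    exact hi.symm.trans (ha.trans hj)
  · have key : ∀ p ∈ ({i, j} : Set α), ∀ a ∈ {a : α → M | a i = a j}, a p = a i := by
      rintro p (rfl | rfl) a ha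
      exacts [rfl, Eq.symm ha]
    intro p hp q hq
    refine ⟨1, fun m => ?_⟩
    rw [Nat.cast_one, Set.encard_le_one_iff]
    rintro _ _ ⟨a, ⟨ha, rfl⟩, rfl⟩ ⟨b, ⟨hb, hab⟩, rfl⟩
    simp only [key p hp a ha, key p hp b hb] at hab
    simp only [key q hq a ha, key q hq b hb, hab]

variable [DecidableEq α]

theorem substUpdate {S : Set (α → M)} (hS : IsMACombination L S) (i : α) (x : M) :
    IsMACombination L {a : α → M | Function.update a i x ∈ S} := by
  have h := hS.subst (β := α) fun j => if j = i then Sum.inr x else Sum.inl j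
  convert h using 2
  funext a
  congr 1
  funext j
  by_cases hj : j = i
  · subst hj; simp
  · simp [hj]

end IsMACombination

-- Fibres in one coordinate and closure under projection.

section Fiber

variable [DecidableEq α]

/-- The fibre of `S` in the direction of the coordinate `i` over the other coordinates of `a`. -/
def coordFiber (S : Set (α → M)) (i : α) (a : α → M) : Set M :=
  {x | Function.update a i x ∈ S}

theorem IsMAOn.trichotomy {G : Set (α → M)} {s : Set α} (hG : IsMAOn L G s) (i : α) :
    (∀ a x, Function.update a i x ∈ G ↔ a ∈ G) ∨ (∀ a b, a i = b i → a ∈ G → b ∈ G) ∨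
      i ∈ s ∧ ∃ j ∈ s, j ≠ i := by
  by_cases hi : i ∈ s
  · by_cases hj : ∃ j ∈ s, j ≠ i
    · exact Or.inr (Or.inr ⟨hi, hj⟩)
    · push Not at hj
      refine Or.inr (Or.inl fun a b hab => hG.congr a b fun j hjs => ?_)
      rw [hj j hjs, hab]
  · refine Or.inl fun a x => ?_
    have : Set.EqOn (Function.update a i x) a s := fun j hj =>
      Function.update_of_ne (by rintro rfl; exact hi hj) _ _
    exact ⟨hG.congr _ _ this, hG.congr _ _ this.symm⟩

theorem IsMAOn.exists_encard_coordFiber_le {G : Set (α → M)} {s : Set α} (hG : IsMAOn L G s)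
    {i : α} (hi : i ∈ s) {j : α} (hj : j ∈ s) (hji : j ≠ i) :
    ∃ K : ℕ, ∀ a, (coordFiber G i a).encard ≤ K := by
  obtain ⟨K, hK⟩ := hG.bounds j hj i hi
  refine ⟨K, fun a => le_trans (Set.encard_le_encard fun x hx => ?_) (hK (a j))⟩
  exact ⟨Function.update a i x, ⟨hx, by simp [hji]⟩, by simp⟩

/-- "At least `p` points in the fibre" stays mutually algebraic, since a single witness places the
remaining coordinates on a point of `T`. For `p = 0` there is no witness and the set is everything.
-/
theorem IsMAOn.exists_injective_update {T : Set (α → M)} {s : Set α} (hT : IsMAOn L T s) (i : α)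
    {p : ℕ} (hp : p ≠ 0) :
    IsMAOn L {a | ∃ x : Fin p → M, Function.Injective x ∧ ∀ t, Function.update a i (x t) ∈ T}
      (s \ {i}) where
  definable := by
    have h1 : ParamDefinable L {b : α ⊕ Fin p → M | (∀ t t', t ≠ t' → b (.inr t) ≠ b (.inr t')) ∧
        ∀ t, (fun j => if j = i then b (.inr t) else b (.inl j)) ∈ T} := by
      have e : ∀ t t' : Fin p, ParamDefinable L
          (if t ≠ t' then {b : α ⊕ Fin p → M | b (.inr t) = b (.inr t')}ᶜ else Set.univ) := by
        intro t t'
        split_ifs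
        · exact (paramDefinable_eq _ _).compl
        · exact Set.definable_univ
      have f : ∀ t : Fin p, ParamDefinable L
          {b : α ⊕ Fin p → M | (fun j => if j = i then b (.inr t) else b (.inl j)) ∈ T} := by
        intro t
        convert hT.definable.preimage_comp
          (fun j => if j = i then (Sum.inr t : α ⊕ Fin p) else Sum.inl j) using 1
        ext b
        simp only [Set.mem_ofPred_eq, Set.mem_preimage]
        rw [iff_iff_eq]
        congr 1
        funext j
        by_cases hj : j = i <;> simp [hj]
      have := (Set.definable_iInter_of_finite fun t => Set.definable_iInter_of_finite (e t)).inter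
        (Set.definable_iInter_of_finite f)
      convert this using 1
      ext b
      simp only [Set.mem_ofPred_eq, Set.mem_inter_iff, Set.mem_iInter]
      refine and_congr (forall_congr' fun t => forall_congr' fun t' => ?_) Iff.rfl
      split_ifs with h <;> simp [h]
    convert h1.exists_of_finite using 1
    ext a
    simp only [Set.mem_ofPred_eq, Sum.elim_inr, Sum.elim_inl]
    refine exists_congr fun x => and_congr ?_ (forall_congr' fun t => ?_)
    · exact ⟨fun h t t' htt h' => htt (h h'), fun h t t' h' => by_contra fun c => h t t' c h'⟩
    · rw [iff_iff_eq]
      congr 1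
      funext j
      by_cases hj : j = i
      · subst hj; simp
      · simp [hj]
  congr := by
    rintro a b hab ⟨x, hx, h⟩
    refine ⟨x, hx, fun t => hT.congr _ _ (fun j hj => ?_) (h t)⟩
    by_cases hji : j = i
    · subst hji; simp
    · simpa [hji] using hab ⟨hj, hji⟩
  bounds := by
    rintro j ⟨hj, hji⟩ k ⟨hk, hki⟩
    obtain ⟨K, hK⟩ := hT.bounds j hj k hk
    refine ⟨K, fun m => le_trans (Set.encard_le_encard ?_) (hK m)⟩
    rintro _ ⟨a, ⟨⟨x, -, hx⟩, rfl⟩, rfl⟩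
    exact ⟨_, ⟨hx ⟨0, Nat.pos_of_ne_zero hp⟩, Function.update_of_ne hji _ _⟩,
      Function.update_of_ne hki _ _⟩

theorem IsMAOn.isMACombination_ncard {T : Set (α → M)} {s : Set α} (hT : IsMAOn L T s) {i : α}
    (hi : i ∈ s) {j : α} (hj : j ∈ s) (hji : j ≠ i) (l : ℕ) :
    IsMACombination L {a | (coordFiber T i a).ncard = l} := by
  have hge : ∀ p : ℕ, IsMACombination L {a | p ≤ (coordFiber T i a).ncard} := by
    intro p
    rcases eq_or_ne p 0 with rfl | hp
    · simpa using IsMACombination.univ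
    · convert (hT.exists_injective_update i hp).isMACombination using 1
      ext a
      obtain ⟨K, hK⟩ := hT.exists_encard_coordFiber_le hi hj hji
      have hfin : (coordFiber T i a).Finite := Set.finite_of_encard_le_coe (hK a)
      simp only [Set.mem_ofPred_eq]
      constructor
      · intro h
        obtain ⟨A, hA, hAc⟩ := Set.exists_subset_card_eq h
        have hAf := hfin.subset hA
        have := hAf.fintype
        have e : Fin p ≃ A := (Fintype.equivFinOfCardEq
          (by rw [← Nat.card_eq_fintype_card, Nat.card_coe_set_eq, hAc])).symm
        exact ⟨fun t => e t, Subtype.val_injective.comp e.injective, fun t => hA (e t).2⟩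
      · rintro ⟨x, hx, h⟩
        have : Set.range x ⊆ coordFiber T i a := by rintro _ ⟨t, rfl⟩; exact h t
        have h2 := Set.ncard_le_ncard this hfin
        rwa [← Nat.card_coe_set_eq, Nat.card_range_of_injective hx, Nat.card_fin] at h2
  convert (hge l).inter (hge (l + 1)).compl using 1
  ext a
  simp only [Set.mem_ofPred_eq, Set.mem_inter_iff, Set.mem_compl_iff]
  omega

/-- Induction on `F` with `T` varying. A cylinder required positively is absorbed into `T`, a
negative one is handled by subtracting cardinalities, and one not involving `i` is a condition on
the base point. Finiteness of the fibres of `T` makes the subtraction legitimate. -/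
theorem IsMAOn.isMACombination_ncard_inter {F : Set (Set (α → M))} (hF : F.Finite)
    (hFg : ∀ G ∈ F, ∃ s, IsMAOn L G s) (P : Set (Set (α → M))) {i j : α} (hji : j ≠ i) :
    ∀ (T : Set (α → M)) (s : Set α), IsMAOn L T s → i ∈ s → j ∈ s → ∀ l : ℕ,
      IsMACombination L
        {a | (coordFiber (T ∩ {b | ∀ G ∈ F, b ∈ G ↔ G ∈ P}) i a).ncard = l} := by
  induction F, hF using Set.Finite.induction_on with
  | empty =>
    intro T s hT hi hj l
    simpa using hT.isMACombination_ncard hi hj hji l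
  | @insert G F hGF hF ih =>
    intro T s hT hi hj l
    specialize ih fun G hG => hFg G (Set.mem_insert_of_mem _ hG)
    have ihT := ih T s hT hi hj
    obtain ⟨t, ht⟩ := hFg G (Set.mem_insert _ _)
    simp only [Set.forall_mem_insert, Set.ofPred_and]
    set R := {b : α → M | ∀ G ∈ F, b ∈ G ↔ G ∈ P} with hR
    by_cases hit : i ∈ t
    · have ihG := ih (T ∩ G) (s ∪ t) (hT.inter ht hi hit) (Or.inl hi) (Or.inl hj)
      by_cases hGP : G ∈ P
      · simpa [hGP, Set.inter_assoc] using ihG l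
      · simp only [hGP, iff_false]
        obtain ⟨K, hK⟩ := hT.exists_encard_coordFiber_le hi hj hji
        have hfin : ∀ a, (coordFiber T i a).Finite := fun a =>
          Set.finite_of_encard_le_coe (hK a)
        have hle : ∀ a, ∀ B ⊆ T, (coordFiber B i a).ncard < K + 1 := by
          intro a B hB
          have h1 : (coordFiber B i a).ncard ≤ (coordFiber T i a).ncard :=
            Set.ncard_le_ncard (fun x hx => hB hx) (hfin a)
          have h2 := hK a
          rw [← (hfin a).cast_ncard_eq, Nat.cast_le] at h2
          omega
        have hsub : ∀ a, (coordFiber (T ∩ ({b | b ∉ G} ∩ R)) i a).ncard =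
            (coordFiber (T ∩ R) i a).ncard - (coordFiber (T ∩ G ∩ R) i a).ncard := by
          intro a
          have hinc : coordFiber (T ∩ G ∩ R) i a ⊆ coordFiber (T ∩ R) i a :=
            fun x hx => ⟨hx.1.1, hx.2⟩
          rw [← Set.ncard_sdiff hinc ((hfin a).subset fun x hx => hx.1.1)]
          congr 1
          ext x
          simp only [coordFiber, Set.mem_ofPred_eq, Set.mem_inter_iff, Set.mem_sdiff]
          tauto
        -- Both cardinalities lie in `0, …, K`, so finitely many sets record them, and the
        -- difference is determined.
        refine IsMACombination.of_determined
          (F := ((fun p => {a | (coordFiber (T ∩ R) i a).ncard = p}) '' Set.Iio (K + 1)) ∪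
            ((fun p => {a | (coordFiber (T ∩ G ∩ R) i a).ncard = p}) '' Set.Iio (K + 1)))
          (((Set.finite_Iio _).image _).union ((Set.finite_Iio _).image _)) ?_ ?_
        · rintro _ (⟨p, -, rfl⟩ | ⟨p, -, rfl⟩)
          exacts [ihT p, ihG p]
        · intro a b hab ha
          have h1 := (hab _ (Or.inl ⟨_, hle a (T ∩ R) Set.inter_subset_left, rfl⟩)).1 rfl
          have h2 := (hab _ (Or.inr ⟨_, hle a (T ∩ G ∩ R) fun x hx => hx.1.1, rfl⟩)).1 rfl
          simp only [Set.mem_ofPred_eq] at h1 h2 ha ⊢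
          rw [hsub] at ha ⊢
          omega
    · have hZ : ∀ a x, Function.update a i x ∈ G ↔ a ∈ G := by
        intro a x
        rcases ht.trichotomy i with h | h | h
        · exact h a x
        · have : Set.EqOn (Function.update a i x) a t := fun j hj =>
            Function.update_of_ne (by rintro rfl; exact hit hj) _ _
          exact ⟨ht.congr _ _ this, ht.congr _ _ this.symm⟩
        · exact absurd h.1 hit
      refine IsMACombination.of_determined (F := {G, {a | (coordFiber (T ∩ R) i a).ncard = l}})
        (by simp) (by rintro _ (rfl | rfl); exacts [ht.isMACombination, ihT l]) ?_
      intro a b hab ha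
      have h1 := hab G (by simp)
      have h2 := hab {a | (coordFiber (T ∩ R) i a).ncard = l} (by simp)
      have hval : ∀ a, coordFiber (T ∩ ({b | b ∈ G ↔ G ∈ P} ∩ R)) i a =
          {x | (a ∈ G ↔ G ∈ P) ∧ x ∈ coordFiber (T ∩ R) i a} := by
        intro a
        ext x
        simp only [coordFiber, Set.mem_ofPred_eq, Set.mem_inter_iff, hZ]
        tauto
      simp only [Set.mem_ofPred_eq, hval] at ha h2 ⊢
      by_cases hP : a ∈ G ↔ G ∈ P
      · have hP' := h1.symm.trans hP
        simpa [hP'] using h2.1 (by simpa [hP] using ha)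
      · have hP' : ¬ (b ∈ G ↔ G ∈ P) := fun h => hP (h1.trans h)
        simpa [hP, hP'] using ha

/-- If the atom lies in a cylinder linking `i` to another coordinate, its fibre is finite and can be
counted. Otherwise such cylinders only remove finitely many points from the set `V` cut out by the
conditions on `i` alone. -/
theorem IsMACombination.exists_update_atom {F : Set (Set (α → M))} (hF : F.Finite)
    (hFg : ∀ G ∈ F, ∃ s, IsMAOn L G s) (P : Set (Set (α → M))) (i : α) :
    IsMACombination L {a | ∃ x, Function.update a i x ∈ {b | ∀ G ∈ F, b ∈ G ↔ G ∈ P}} := by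
  set R := {b : α → M | ∀ G ∈ F, b ∈ G ↔ G ∈ P} with hR
  by_cases hpos : ∃ G ∈ F, G ∈ P ∧ ∃ s, IsMAOn L G s ∧ i ∈ s ∧ ∃ j ∈ s, j ≠ i
  · obtain ⟨G, hG, hGP, s, hs, hi, j, hj, hji⟩ := hpos
    convert (IsMAOn.isMACombination_ncard_inter hF hFg P hji G s hs hi hj 0).compl using 1
    ext a
    obtain ⟨K, hK⟩ := hs.exists_encard_coordFiber_le hi hj hji
    have hfin : (coordFiber (G ∩ R) i a).Finite :=
      (Set.finite_of_encard_le_coe (hK a)).subset fun x hx => hx.1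
    simp only [Set.mem_compl_iff, Set.mem_ofPred_eq]
    rw [Set.ncard_eq_zero hfin, ← Ne, ← Set.nonempty_iff_ne_empty]
    exact exists_congr fun x => ⟨fun h => ⟨(h G hG).2 hGP, h⟩, fun h => h.2⟩
  · push Not at hpos
    let V : Set M := {x | ∀ G ∈ F, (∀ a b : α → M, a i = b i → a ∈ G → b ∈ G) →
      ∀ a : α → M, a i = x → (a ∈ G ↔ G ∈ P)}
    by_cases hV : V.Finite
    · have hRc : IsMACombination L R := ⟨F, hF, hFg, fun a b hab ha G hG =>
        (hab G hG).symm.trans (ha G hG)⟩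
      convert IsMACombination.biUnion hV fun x _ => hRc.substUpdate i x using 1
      ext a
      simp only [Set.mem_ofPred_eq, Set.mem_iUnion, exists_prop]
      refine exists_congr fun x => ⟨fun h => ⟨fun G hG hU b hb => ?_, h⟩, fun h => h.2⟩
      rw [← h G hG]
      have : (Function.update a i x) i = b i := by simp [hb]
      exact ⟨hU _ _ this.symm, hU _ _ this⟩
    -- With `V` infinite, some point always avoids the finite set removed, so only the cylinders
    -- independent of `i` matter; these have the same truth value at `a` and `b`.
    · refine IsMACombination.of_determined hF
        (fun G hG => (hFg G hG).choose_spec.isMACombination) ?_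
      rintro a b hab ⟨x, hx⟩
      have hbad : (⋃ G ∈ {G ∈ F | ∃ K : ℕ, ∀ a, (coordFiber G i a).encard ≤ K},
          coordFiber G i b).Finite := by
        refine (hF.subset (Set.sep_subset _ _)).biUnion ?_
        rintro G ⟨-, K, hK⟩
        exact Set.finite_of_encard_le_coe (hK b)
      obtain ⟨y, hyV, hy⟩ := (Set.Infinite.sdiff hV hbad).nonempty
      refine ⟨y, fun G hG => ?_⟩
      obtain ⟨s, hs⟩ := hFg G hG
      rcases hs.trichotomy i with h | h | ⟨hi, j, hj, hji⟩
      · rw [h, ← hab G hG, ← hx G hG, h]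
      · exact hyV G hG h _ (by simp)
      · have h1 : G ∉ P := fun hGP => hji (hpos G hG hGP s hs hi j hj)
        refine iff_of_false (fun h => hy ?_) h1
        simp only [Set.mem_iUnion]
        exact ⟨G, ⟨hG, hs.exists_encard_coordFiber_le hi hj hji⟩, h⟩

/-- Projection commutes with unions, and `S` is the finite union of the atoms contained in it. -/
theorem IsMACombination.exists_update {S : Set (α → M)} (hS : IsMACombination L S) (i : α) :
    IsMACombination L {a | ∃ x, Function.update a i x ∈ S} := by
  obtain ⟨F, hF, hFg, hFS⟩ := hS
  convert IsMACombination.biUnion (A := {P ∈ F.powerset | {b : α → M | ∀ G ∈ F, b ∈ G ↔ G ∈ P} ⊆ S})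
    (hF.finite_subsets.subset (Set.sep_subset _ _))
    (fun P _ => IsMACombination.exists_update_atom hF hFg P i) using 1
  ext a
  simp only [Set.mem_ofPred_eq, Set.mem_iUnion, Set.mem_powerset_iff, exists_prop]
  constructor
  · rintro ⟨x, hx⟩
    refine ⟨{G ∈ F | Function.update a i x ∈ G}, ⟨Set.sep_subset _ _, ?_⟩, x, ?_⟩
    · intro b hb
      refine hFS _ _ (fun G hG => ?_) hx
      rw [hb G hG]
      simp [hG]
    · intro G hG
      simp [hG]
  · rintro ⟨P, ⟨-, hP⟩, x, hx⟩
    exact ⟨x, hP hx⟩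

end Fiber

end Combinatorics

-- Combinations are exactly the sets of `MA*(M)`, and the reduct exists.

section Reduct

variable {L : Language.{u, v}} {M : Type w} [L.Structure M]

theorem IsMAOn.of_isMutuallyAlgebraicSet {k n : ℕ} {B : Set (Fin k → M)}
    (hdef : ParamDefinable L B) (hB : IsMutuallyAlgebraicSet B) (f : Fin k ↪ Fin n) :
    IsMAOn L {a : Fin n → M | a ∘ f ∈ B} (Set.range f) where
  definable := hdef.preimage_comp f
  congr a b hab h := by
    have : a ∘ f = b ∘ f := funext fun i => hab ⟨i, rfl⟩
    simpa [← this] using h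
  bounds := by
    rintro _ ⟨p, rfl⟩ _ ⟨q, rfl⟩
    rcases eq_or_ne p q with rfl | hpq
    · exact BoundsCoord.refl _ _
    obtain ⟨K, hK⟩ := hB
    refine ⟨K, fun m => ?_⟩
    by_cases hex : ∃ b ∈ B, b p = m
    · obtain ⟨b, hb, rfl⟩ := hex
      refine le_trans ?_ (hK {p} ⟨p, rfl⟩ ⟨q, hpq.symm⟩ b hb)
      refine le_trans (Set.encard_le_encard ?_) (Set.encard_image_le (fun a : Fin k → M => a q) _)
      rintro _ ⟨a, ⟨ha, hap⟩, rfl⟩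
      exact ⟨a ∘ f, ⟨ha, by rintro _ rfl; exact hap⟩, rfl⟩
    · convert bot_le
      rw [Set.encard_eq_zero.2]
      · rfl
      · rw [Set.image_eq_empty, Set.eq_empty_iff_forall_notMem]
        rintro a ⟨ha, hap⟩
        exact hex ⟨a ∘ f, ha, hap⟩

theorem IsMAOn.isMutuallyAlgebraicSet {k : ℕ} {B : Set (Fin k → M)}
    (hB : IsMAOn L B Set.univ) : IsMutuallyAlgebraicSet B := by
  classical
  choose K hK using fun i j => hB.bounds i trivial j trivial
  let N := ∑ i, ∑ j, K i j
  have hN : ∀ i j, K i j ≤ N := fun i j =>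
    (Finset.single_le_sum (f := fun j => K i j) (fun _ _ => Nat.zero_le _)
      (Finset.mem_univ j)).trans
    (Finset.single_le_sum (f := fun i => ∑ j, K i j) (fun _ _ => Nat.zero_le _)
      (Finset.mem_univ i))
  -- Fixing one coordinate `p ∈ Y` leaves at most `N` values for each coordinate, so the fibre sits
  -- in a box of size at most `N ^ k`.
  refine ⟨N ^ k, ?_⟩
  rintro Y ⟨p, hp⟩ - b -
  have hfin : ∀ q, ((fun a : Fin k → M => a q) '' {a ∈ B | a p = b p}).Finite := fun q =>
    Set.finite_of_encard_le_coe (hK p q (b p))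
  have hsub : {a ∈ B | ∀ i ∈ Y, a i = b i} ⊆
      (Fintype.piFinset fun q => (hfin q).toFinset : Finset (Fin k → M)) := by
    rintro a ⟨ha, haY⟩
    simp only [Finset.mem_coe, Fintype.mem_piFinset, Set.Finite.mem_toFinset]
    exact fun q => ⟨a, ⟨ha, haY p hp⟩, rfl⟩
  refine (Set.encard_le_encard hsub).trans ?_
  rw [Set.encard_coe_eq_coe_finsetCard, Nat.cast_le, Fintype.card_piFinset]
  calc _ ≤ ∏ _q : Fin k, N := Finset.prod_le_prod' fun q _ => ?_
    _ = N ^ k := by simp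
  have := hK p q (b p)
  rw [(hfin q).encard_eq_coe_toFinset_card, Nat.cast_le] at this
  exact this.trans (hN p q)

theorem IsBoolCombMA.isMACombination {n : ℕ} {φ : L[[M]].Formula (Fin n)}
    (h : IsBoolCombMA L M φ) : IsMACombination L {a : Fin n → M | φ.Realize a} := by
  induction h with
  | of φ hφ f =>
    convert (IsMAOn.of_isMutuallyAlgebraicSet (paramDefinable_iff.2 ⟨φ, rfl⟩)
      hφ f).isMACombination using 1
    ext a
    simp [Formula.realize_relabel]
  | bot =>
    convert IsMACombination.empty using 1
    ext a
    simp
  | not _ ih =>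
    convert ih.compl using 1
    ext a
    simp
  | inf _ _ ih ih' =>
    convert ih.inter ih' using 1
    ext a
    simp

/-- The sets defined by boolean combinations of mutually algebraic formulas. -/
def IsBoolCombMASet (L : Language.{u, v}) {M : Type w} [L.Structure M] {n : ℕ}
    (S : Set (Fin n → M)) : Prop :=
  ∃ ψ : L[[M]].Formula (Fin n), IsBoolCombMA L M ψ ∧ S = {a | ψ.Realize a}

namespace IsBoolCombMASet

variable {n : ℕ}

theorem compl {S : Set (Fin n → M)} (hS : IsBoolCombMASet L S) : IsBoolCombMASet L Sᶜ := by
  obtain ⟨ψ, hψ, rfl⟩ := hS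
  exact ⟨_, hψ.not, by ext; simp⟩

theorem inter {S T : Set (Fin n → M)} (hS : IsBoolCombMASet L S) (hT : IsBoolCombMASet L T) :
    IsBoolCombMASet L (S ∩ T) := by
  obtain ⟨ψ, hψ, rfl⟩ := hS
  obtain ⟨χ, hχ, rfl⟩ := hT
  exact ⟨_, hψ.inf hχ, by ext; simp⟩

theorem univ : IsBoolCombMASet L (Set.univ : Set (Fin n → M)) :=
  ⟨_, IsBoolCombMA.bot.not, by ext; simp⟩

theorem biInter {ι : Type*} {A : Set ι} (hA : A.Finite) {f : ι → Set (Fin n → M)}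
    (h : ∀ i ∈ A, IsBoolCombMASet L (f i)) : IsBoolCombMASet L (⋂ i ∈ A, f i) := by
  induction A, hA using Set.Finite.induction_on with
  | empty => simpa using univ
  | @insert i A _ _ ih =>
    rw [Set.biInter_insert]
    exact (h i (Set.mem_insert _ _)).inter (ih fun j hj => h j (Set.mem_insert_of_mem _ hj))

theorem biUnion {ι : Type*} {A : Set ι} (hA : A.Finite) {f : ι → Set (Fin n → M)}
    (h : ∀ i ∈ A, IsBoolCombMASet L (f i)) : IsBoolCombMASet L (⋃ i ∈ A, f i) := by
  rw [← compl_compl (⋃ i ∈ A, f i)]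
  simp only [Set.compl_iUnion]
  exact (biInter hA fun i hi => (h i hi).compl).compl

end IsBoolCombMASet

theorem IsMAOn.isBoolCombMASet [Nonempty M] {n : ℕ} {G : Set (Fin n → M)} {s : Set (Fin n)}
    (hG : IsMAOn L G s) : IsBoolCombMASet L G := by
  classical
  let e : Fin (Fintype.card s) ≃ s := (Fintype.equivFin s).symm
  let m : M := Classical.arbitrary M
  let g : Fin n → Fin (Fintype.card s) ⊕ M := fun i =>
    -- Coordinates outside `s` are frozen at an arbitrary `m`, which is harmless because `G` ignores
    -- them; this leaves a set in its true variables.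
    if h : i ∈ s then Sum.inl (e.symm ⟨i, h⟩) else Sum.inr m
  have hB := hG.subst g
  have hsupp : {j | ∃ i ∈ s, g i = Sum.inl j} = Set.univ :=
    Set.eq_univ_of_forall fun j => ⟨e j, (e j).2, by simp [g]⟩
  rw [hsupp] at hB
  obtain ⟨φ, hφ⟩ := paramDefinable_iff.1 hB.definable
  have hMA : IsMAFormula L M φ := by
    rw [IsMAFormula, ← hφ]
    exact hB.isMutuallyAlgebraicSet
  let f : Fin (Fintype.card s) ↪ Fin n := e.toEmbedding.trans (Function.Embedding.subtype _)
  refine ⟨_, IsBoolCombMA.of φ hMA f, ?_⟩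
  ext a
  have key : a ∘ f ∈ {a | φ.Realize a} ↔
      (fun i => Sum.elim (a ∘ f) id (g i)) ∈ G := by rw [← hφ]; rfl
  have hEq : Set.EqOn (fun i => Sum.elim (a ∘ f) id (g i)) a s := fun i hi => by
    simp [g, hi, f]
  simp only [Set.mem_ofPred_eq, Formula.realize_relabel] at key ⊢
  rw [key]
  exact ⟨hG.congr _ _ hEq.symm, hG.congr _ _ hEq⟩

theorem IsMACombination.isBoolCombMASet [Nonempty M] {n : ℕ} {S : Set (Fin n → M)}
    (hS : IsMACombination L S) : IsBoolCombMASet L S := by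
  classical
  obtain ⟨F, hF, hFg, hFS⟩ := hS
  have hG : ∀ G ∈ F, IsBoolCombMASet L G := fun G hG => (hFg G hG).choose_spec.isBoolCombMASet
  have hat : ∀ P : Set (Set (Fin n → M)),
      IsBoolCombMASet L (⋂ G ∈ F, if G ∈ P then G else Gᶜ) := fun P =>
    IsBoolCombMASet.biInter hF fun G hGF => by
      split_ifs
      exacts [hG G hGF, (hG G hGF).compl]
  convert IsBoolCombMASet.biUnion (f := fun P => ⋂ G ∈ F, if G ∈ P then G else Gᶜ)
    (A := {P ∈ F.powerset | (⋂ G ∈ F, if G ∈ P then G else Gᶜ) ⊆ S})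
    (hF.finite_subsets.subset (Set.sep_subset _ _)) (fun P _ => hat P) using 1
  have hmem : ∀ (P : Set (Set (Fin n → M))) (a : Fin n → M),
      (a ∈ ⋂ G ∈ F, if G ∈ P then G else Gᶜ) ↔ ∀ G ∈ F, a ∈ G ↔ G ∈ P := by
    intro P a
    simp only [Set.mem_iInter]
    refine forall_congr' fun G => forall_congr' fun _ => ?_
    split_ifs with h <;> simp [h]
  ext a
  simp only [Set.mem_iUnion, exists_prop]
  constructor
  · intro ha
    refine ⟨{G ∈ F | a ∈ G}, ⟨Set.sep_subset _ _, fun b hb => ?_⟩, ?_⟩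
    · rw [hmem] at hb
      refine hFS a b (fun G hG => ?_) ha
      rw [hb G hG]
      simp [hG]
    · rw [hmem]
      intro G hG
      simp [hG]
  · rintro ⟨P, ⟨-, hP⟩, ha⟩
    exact hP ha

/-- The universal closure of `φ ↔ ψ` is a sentence with parameters, so its truth in `M` passes to
all models of the elementary diagram. -/
theorem iff_elementaryDiagram [Nonempty M] {n : ℕ} {φ ψ : L[[M]].Formula (Fin n)} :
    (φ ⇔[L.elementaryDiagram M] ψ) ↔ ∀ a : Fin n → M, φ.Realize a ↔ ψ.Realize a := by
  constructor
  · intro h a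
    exact h.realize_iff
  · intro h N v xs
    have hs : M ⊨ (BoundedFormula.relabel (Sum.inr : Fin n → Empty ⊕ Fin n) (φ.iff ψ)).alls := by
      rw [Sentence.Realize, BoundedFormula.realize_alls]
      intro a
      rw [Formula.realize_relabel_sumInr]
      simpa using h a
    have hN := (realize_iff_of_model_completeTheory M N _).2 hs
    rw [Sentence.Realize, BoundedFormula.realize_alls] at hN
    have := hN v
    rw [Formula.realize_relabel_sumInr] at this
    rwa [Formula.Realize, Subsingleton.elim default xs] at this

theorem isMAStar_iff [Nonempty M] {n : ℕ} {φ : L[[M]].Formula (Fin n)} :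
    IsMAStar L M φ ↔ IsMACombination L {a : Fin n → M | φ.Realize a} := by
  constructor
  · rintro ⟨ψ, hψ, h⟩
    rw [iff_elementaryDiagram] at h
    simpa only [h] using hψ.isMACombination
  · intro h
    obtain ⟨ψ, hψ, h⟩ := h.isBoolCombMASet
    exact ⟨ψ, hψ, iff_elementaryDiagram.2 fun a => Set.ext_iff.1 h a⟩

/-- The sets defined by formulas of `MA*(M)` are those determined by finitely many mutually
algebraic ones. -/
theorem exists_isMAStar_iff [Nonempty M] {n : ℕ} {S : Set (Fin n → M)} :
    (∃ φ : L[[M]].Formula (Fin n), IsMAStar L M φ ∧ S = {a | φ.Realize a}) ↔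
      IsMACombination L S := by
  constructor
  · rintro ⟨φ, hφ, rfl⟩
    exact isMAStar_iff.1 hφ
  · intro hS
    obtain ⟨φ, -, hφ⟩ := hS.isBoolCombMASet
    exact ⟨φ, isMAStar_iff.2 (hφ ▸ hS), hφ⟩

theorem IsMACombination.realize_maLanguage [Nonempty M] {α : Type*} :
    ∀ {k : ℕ} (φ : (maLanguage L M).BoundedFormula α k),
      IsMACombination L {a : α ⊕ Fin k → M | φ.Realize (a ∘ Sum.inl) (a ∘ Sum.inr)} := by
  classical
  have hterm : ∀ {k : ℕ} (t : (maLanguage L M).Term (α ⊕ Fin k)), ∃ i, t = Term.var i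
    | _, .var i => ⟨i, rfl⟩
    | _, .func f _ => Empty.elim f
  intro k φ
  induction φ with
  | falsum => exact IsMACombination.empty
  | equal t₁ t₂ =>
    obtain ⟨i, rfl⟩ := hterm t₁
    obtain ⟨j, rfl⟩ := hterm t₂
    convert IsMACombination.eq i j using 1
    ext a
    simp [BoundedFormula.Realize]
  | rel R ts =>
    choose g hg using fun i => hterm (ts i)
    convert (isMAStar_iff.1 R.2).preimage_comp g using 1
    ext a
    simp only [BoundedFormula.Realize, Set.mem_ofPred_eq, hg, Term.realize_var,
      Sum.elim_comp_inl_inr]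
    rfl
  | imp φ ψ ih ih' =>
    convert (ih.inter ih'.compl).compl using 1
    ext a
    simp [BoundedFormula.realize_imp]
  | @all k φ ih =>
    -- After projection the last coordinate is a dummy; substituting an arbitrary element removes
    -- it.
    have h := (ih.compl.exists_update (Sum.inr (Fin.last k))).compl.subst (β := α ⊕ Fin k)
      (Sum.elim (fun i => Sum.inl (Sum.inl i))
        (Fin.lastCases (Sum.inr (Classical.arbitrary M)) fun i => Sum.inl (Sum.inr i)))
    convert h using 1
    ext a
    simp only [BoundedFormula.realize_all, Set.mem_ofPred_eq, Set.mem_compl_iff, not_exists,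
      not_not]
    refine forall_congr' fun x => ?_
    rw [iff_iff_eq]
    congr 1
    funext i
    refine Fin.lastCases ?_ (fun i => ?_) i
    · simp
    · simp

theorem isMAReduct_maLanguage [Nonempty M] : IsMAReduct L M (maLanguage L M) := by
  intro n S
  rw [Set.empty_definable_iff]
  constructor
  · rintro ⟨φ, rfl⟩
    rw [exists_isMAStar_iff]
    convert (IsMACombination.realize_maLanguage (L := L) φ).subst (β := Fin n)
      (Sum.elim Sum.inl finZeroElim) using 1
    ext a
    simp only [Set.mem_ofPred_eq, Formula.Realize]
    rw [iff_iff_eq]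
    congr 1
    exact Subsingleton.elim _ _
  · rintro ⟨φ, hφ, rfl⟩
    let R : (maLanguage L M).Relations n := ⟨φ, hφ⟩
    refine ⟨R.formula Term.var, ?_⟩
    ext a
    simp only [Set.mem_ofPred_eq, Formula.realize_rel, Term.realize_var]
    rfl

end Reduct

-- Helly numbers for fibres of combinations.

section FiniteCover

variable {L : Language.{u, v}} {M : Type w} [L.Structure M] {α : Type u'}

theorem exists_encard_biUnion_coordFiber_le [DecidableEq α] {A : Set (Set (α → M))}
    (hA : A.Finite) (i : α) (h : ∀ G ∈ A, ∃ K : ℕ, ∀ a, (coordFiber G i a).encard ≤ K) :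
    ∃ N : ℕ, ∀ a, (⋃ G ∈ A, coordFiber G i a).encard ≤ N := by
  induction A, hA using Set.Finite.induction_on with
  | empty => exact ⟨0, by simp⟩
  | @insert G A _ _ ih =>
    obtain ⟨N, hN⟩ := ih fun G hG => h G (Set.mem_insert_of_mem _ hG)
    obtain ⟨K, hK⟩ := h G (Set.mem_insert _ _)
    refine ⟨K + N, fun a => ?_⟩
    rw [Set.biUnion_insert]
    refine (Set.encard_union_le _ _).trans ?_
    push_cast
    exact add_le_add (hK a) (hN a)

/-- Intersections of finitely many fibres of a fixed set in one direction satisfy a Helly type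
theorem. -/
theorem IsMACombination.exists_helly_coord [DecidableEq α] {S : Set (α → M)}
    (hS : IsMACombination L S) (i : α) :
    ∃ k : ℕ, ∀ C : Finset (α → M),
      (∀ D ⊆ C, D.card ≤ k → ∃ x, ∀ c ∈ D, Function.update c i x ∈ S) →
      ∃ x, ∀ c ∈ C, Function.update c i x ∈ S := by
  classical
  obtain ⟨F, hF, hFg, hFS⟩ := hS
  obtain ⟨N, hN⟩ := exists_encard_biUnion_coordFiber_le
    (A := {G ∈ F | ∃ K : ℕ, ∀ a, (coordFiber G i a).encard ≤ K})
    (hF.subset (Set.sep_subset _ _)) i fun G hG => hG.2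
  set E : (α → M) → Set M := fun a =>
    ⋃ G ∈ {G ∈ F | ∃ K : ℕ, ∀ a, (coordFiber G i a).encard ≤ K}, coordFiber G i a with hE
  have hEfin : ∀ a, (E a).Finite := fun a => Set.finite_of_encard_le_coe (hN a)
  -- Cells of `M` cut out by the cylinders that depend on the coordinate `i` alone. On a cell, away
  -- from `E c`, the fibre over `c` is all or nothing.
  let V : Finset (Set (α → M)) → Set M := fun P =>
    {x | ∀ G ∈ F, (∀ a b : α → M, a i = b i → a ∈ G → b ∈ G) →
      ∀ a : α → M, a i = x → (a ∈ G ↔ G ∈ P)}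
  have hcell : ∀ (P : Finset (Set (α → M))) (c : α → M), ∀ x ∈ V P, ∀ y ∈ V P, x ∉ E c → y ∉ E c →
      Function.update c i x ∈ S → Function.update c i y ∈ S := by
    intro P c x hx y hy hxE hyE
    refine hFS _ _ fun G hG => ?_
    obtain ⟨s, hs⟩ := hFg G hG
    rcases hs.trichotomy i with h | h | ⟨hi, j, hj, hji⟩
    · rw [h, h]
    · rw [hx G hG h _ (by simp), hy G hG h _ (by simp)]
    · have hb := hs.exists_encard_coordFiber_le hi hj hji
      refine iff_of_false (fun h => hxE ?_) (fun h => hyE ?_)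
      · exact Set.mem_biUnion (show G ∈ {G ∈ F | _} from ⟨hG, hb⟩) h
      · exact Set.mem_biUnion (show G ∈ {G ∈ F | _} from ⟨hG, hb⟩) h
  -- A finite cell is emptied by one member of `C` per point; an infinite one, whose `ncard` is `0`,
  -- needs at most `N + 1` members. Neither bound depends on `C`.
  refine ⟨∑ P ∈ hF.toFinset.powerset, ((V P).ncard + (N + 1)), fun C hC => ?_⟩
  by_contra hcon
  push Not at hcon
  choose r hrC hr using hcon
  have hcov : ∀ P : Finset (Set (α → M)), ∃ D ⊆ C, D.card ≤ (V P).ncard + (N + 1) ∧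
      ∀ x ∈ V P, ∃ c ∈ D, Function.update c i x ∉ S := by
    intro P
    by_cases hV : (V P).Finite
    · refine ⟨hV.toFinset.image r, ?_, ?_, ?_⟩
      · intro c hc
        obtain ⟨x, -, rfl⟩ := Finset.mem_image.1 hc
        exact hrC x
      · rw [Set.ncard_eq_toFinset_card _ hV]
        exact Finset.card_image_le.trans (Nat.le_add_right _ _)
      · exact fun x hx => ⟨r x, Finset.mem_image_of_mem _ (hV.mem_toFinset.2 hx), hr x⟩
    -- The point `y` is generic for all of `C`. Hence `r y`, which excludes `y`, excludes the whole
    -- cell outside `E (r y)`, and the at most `N` points left take one further member each.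
    · obtain ⟨y, hyV, hy⟩ := (Set.Infinite.sdiff hV
        (C.finite_toSet.biUnion fun c _ => hEfin c)).nonempty
      have hyE : y ∉ E (r y) := fun h => hy (Set.mem_biUnion (hrC y) h)
      refine ⟨insert (r y) ((hEfin (r y)).toFinset.image r), ?_, ?_, ?_⟩
      · intro c hc
        rcases Finset.mem_insert.1 hc with rfl | hc
        · exact hrC y
        · obtain ⟨x, -, rfl⟩ := Finset.mem_image.1 hc
          exact hrC x
      · have h1 := hN (r y)
        rw [(hEfin (r y)).encard_eq_coe_toFinset_card, Nat.cast_le] at h1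
        have h2 := Finset.card_insert_le (r y) ((hEfin (r y)).toFinset.image r)
        have h3 := Finset.card_image_le (f := r) (s := (hEfin (r y)).toFinset)
        omega
      · intro x hx
        by_cases hxE : x ∈ E (r y)
        · exact ⟨r x, Finset.mem_insert_of_mem
            (Finset.mem_image_of_mem _ ((hEfin (r y)).mem_toFinset.2 hxE)), hr x⟩
        · exact ⟨r y, Finset.mem_insert_self _ _, fun h =>
            hr y (hcell P (r y) x hx y hyV hxE hyE h)⟩
  choose D hDC hDcard hD using hcov
  obtain ⟨x, hx⟩ := hC (hF.toFinset.powerset.biUnion D)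
    (Finset.biUnion_subset.2 fun P _ => hDC P)
    (Finset.card_biUnion_le.trans (Finset.sum_le_sum fun P _ => hDcard P))
  let P : Finset (Set (α → M)) := hF.toFinset.filter fun G => ∃ a : α → M, a i = x ∧ a ∈ G
  have hxP : x ∈ V P := by
    intro G hG hU a ha
    simp only [P, Finset.mem_filter, Set.Finite.mem_toFinset, hG, true_and]
    exact ⟨fun h => ⟨a, ha, h⟩, fun ⟨b, hb, h⟩ => hU b a (hb.trans ha.symm) h⟩
  obtain ⟨c, hc, hcx⟩ := hD P x hxP
  exact hcx (hx c (Finset.mem_biUnion.2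
    ⟨P, Finset.mem_powerset.2 (Finset.filter_subset _ _), hc⟩))

/-- Induction on `m`: given the other coordinates, a value of the first exists as soon as any `k₁`
conditions allow one. The set `T` says this for one `k₁`-tuple and is a combination by projection,
so the inductive Helly number `k₂` applies to all `k₁`-tuples from `C`; `k₂` such tuples mention at
most `k₂ * k₁` members. -/
theorem IsMACombination.exists_helly [Nonempty M] (m : ℕ) {β : Type u'}
    {S : Set (Fin m ⊕ β → M)} (hS : IsMACombination L S) :
    ∃ k : ℕ, ∀ C : Finset (β → M),
      (∀ D ⊆ C, D.card ≤ k → ∃ a : Fin m → M, ∀ c ∈ D, Sum.elim a c ∈ S) →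
      ∃ a : Fin m → M, ∀ c ∈ C, Sum.elim a c ∈ S := by
  classical
  induction m generalizing β with
  | zero =>
    refine ⟨1, fun C hC => ⟨finZeroElim, fun c hc => ?_⟩⟩
    obtain ⟨a, ha⟩ := hC {c} (by simpa using hc) (by simp)
    convert ha c (by simp) using 2
  | succ m ih =>
    obtain ⟨k₁, hk₁⟩ := hS.exists_helly_coord (Sum.inl 0)
    have hupd : ∀ (x : M) (a : Fin m → M) (c : β → M) (y : M),
        Function.update (Sum.elim (Fin.cons y a : Fin (m + 1) → M) c) (Sum.inl 0) x =
          Sum.elim (Fin.cons x a : Fin (m + 1) → M) c := by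
      intro x a c y
      funext j
      rcases j with j | j
      · refine Fin.cases ?_ (fun j => ?_) j <;> simp
      · simp
    let T : Set (Fin m ⊕ (Fin k₁ × β) → M) := {b | ∃ x, ∀ t : Fin k₁,
      Sum.elim (Fin.cons x (b ∘ Sum.inl) : Fin (m + 1) → M) (fun j => b (Sum.inr (t, j))) ∈ S}
    have hT : IsMACombination L T := by
      have h1 := IsMACombination.biInter (Set.finite_univ (α := Fin k₁)) fun t _ =>
        hS.preimage_comp (Sum.map id (fun j : β => (t, j)) : Fin (m + 1) ⊕ β → _)
      convert (h1.exists_update (Sum.inl 0)).subst (β := Fin m ⊕ (Fin k₁ × β))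
        (Sum.elim (Fin.cons (Sum.inr (Classical.arbitrary M)) fun j => Sum.inl (Sum.inl j))
          fun p => Sum.inl (Sum.inr p)) using 1
      ext b
      simp only [T, Set.mem_ofPred_eq, Set.mem_iInter, Set.mem_univ, true_imp_iff]
      refine exists_congr fun x => forall_congr' fun t => ?_
      rw [iff_iff_eq]
      congr 1
      funext j
      rcases j with j | j
      · refine Fin.cases ?_ (fun j => ?_) j <;> simp
      · simp
    obtain ⟨k₂, hk₂⟩ := ih hT
    refine ⟨k₂ * k₁, fun C hC => ?_⟩
    let U : (Fin k₁ → β → M) → (Fin k₁ × β → M) := fun f p => f p.1 p.2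
    obtain ⟨a, ha⟩ := hk₂ ((Fintype.piFinset fun _ : Fin k₁ => C).image U) (by
      intro D hD hDcard
      obtain ⟨a, ha⟩ := hC (D.biUnion fun d => Finset.univ.image fun t j => d (t, j)) (by
          refine Finset.biUnion_subset.2 fun d hd => Finset.image_subset_iff.2 fun t _ => ?_
          obtain ⟨f, hf, rfl⟩ := Finset.mem_image.1 (hD hd)
          exact Fintype.mem_piFinset.1 hf t) (by
          refine (Finset.card_biUnion_le_card_mul _ _ k₁ fun d _ => ?_).trans
            (Nat.mul_le_mul_right _ hDcard)
          exact Finset.card_image_le.trans (by simp))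
      refine ⟨Fin.tail a, fun d hd => ⟨a 0, fun t => ?_⟩⟩
      have := ha (fun j => d (t, j)) (Finset.mem_biUnion.2
        ⟨d, hd, Finset.mem_image_of_mem _ (Finset.mem_univ t)⟩)
      rw [← Fin.cons_self_tail a] at this
      exact this)
    let y : M := Classical.arbitrary M
    obtain ⟨x, hx⟩ := hk₁ (C.image fun c => Sum.elim (Fin.cons y a : Fin (m + 1) → M) c) (by
      intro D hD hDcard
      -- A nonempty `D` is enumerated by `Fin k₁` with repetitions; the empty one may have no such
      -- enumeration.
      rcases D.eq_empty_or_nonempty with rfl | ⟨d₀, hd₀⟩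
      · exact ⟨y, by simp⟩
      have : Nonempty D := ⟨⟨d₀, hd₀⟩⟩
      obtain ⟨e⟩ : Nonempty (D ↪ Fin k₁) := Function.Embedding.nonempty_of_card_le (by simpa)
      have hsurj := Function.invFun_surjective e.injective
      choose f hfC hf using fun t => Finset.mem_image.1 (hD (Function.invFun e t).2)
      obtain ⟨x, hx⟩ := ha (U f) (Finset.mem_image_of_mem _ (Fintype.mem_piFinset.2 hfC))
      refine ⟨x, fun d hd => ?_⟩
      obtain ⟨t, ht⟩ := hsurj ⟨d, hd⟩
      have hd' : Sum.elim (Fin.cons y a : Fin (m + 1) → M) (f t) = d :=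
        (hf t).trans (congrArg Subtype.val ht)
      rw [← hd', hupd]
      exact hx t)
    refine ⟨Fin.cons x a, fun c hc => ?_⟩
    have := hx _ (Finset.mem_image_of_mem _ hc)
    rwa [hupd] at this

end FiniteCover

-- First-order expression of the Helly property, and compactness.

section Transfer

variable {L : Language.{u, v}} {m n : ℕ}

/-- The formula saying that the instances of `φ` at the tuples of variables with index in `D` have
a common solution. -/
noncomputable def existsInstances (φ : L.Formula (Fin m ⊕ Fin n)) {s : ℕ} (D : Finset (Fin s)) :
    L.Formula (Fin s × Fin n) :=
  Formula.iExs (Fin m) (Formula.iInf fun t : D =>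
    φ.relabel (Sum.elim Sum.inr fun j => Sum.inl (t.1, j)))

theorem realize_existsInstances (φ : L.Formula (Fin m ⊕ Fin n)) {s : ℕ} (D : Finset (Fin s))
    {N : Type w} [L.Structure N] (v : Fin s × Fin n → N) :
    (existsInstances φ D).Realize v ↔
      ∃ a : Fin m → N, ∀ t ∈ D, φ.Realize (Sum.elim a fun j => v (t, j)) := by
  simp only [existsInstances, Formula.realize_iExs, Formula.realize_iInf, Formula.realize_relabel,
    Subtype.forall]
  refine exists_congr fun a => forall_congr' fun t => forall_congr' fun _ => ?_
  rw [iff_iff_eq]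
  congr 1
  funext j
  rcases j with j | j <;> rfl

/-- The sentence saying that `s` instances of `φ` have a common solution if any `k` of them do. -/
noncomputable def hellySentence (φ : L.Formula (Fin m ⊕ Fin n)) (k s : ℕ) : L.Sentence :=
  Formula.iAlls (Fin s × Fin n) (Formula.relabel Sum.inr
    ((Formula.iInf fun D : {D : Finset (Fin s) // D.card ≤ k} => existsInstances φ D.1).imp
      (existsInstances φ Finset.univ)))

theorem realize_hellySentence (φ : L.Formula (Fin m ⊕ Fin n)) (k s : ℕ)
    {N : Type w} [L.Structure N] :
    N ⊨ hellySentence φ k s ↔ ∀ c : Fin s → Fin n → N,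
      (∀ D : Finset (Fin s), D.card ≤ k →
        ∃ a : Fin m → N, ∀ t ∈ D, φ.Realize (Sum.elim a (c t))) →
      ∃ a : Fin m → N, ∀ t, φ.Realize (Sum.elim a (c t)) := by
  rw [Sentence.Realize, hellySentence, Formula.realize_iAlls]
  simp only [Formula.realize_relabel, Formula.realize_imp, Formula.realize_iInf, Subtype.forall,
    realize_existsInstances, Finset.mem_univ, true_imp_iff]
  exact ⟨fun h c => h fun p => c p.1 p.2, fun h v => h fun t j => v (t, j)⟩

/-- The formula `φ(x̄, c)` with parameters. -/
def instanceFormula {N : Type w} (φ : L.Formula (Fin m ⊕ Fin n)) (c : Fin n → N) :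
    L[[N]].Formula (Fin m) :=
  BoundedFormula.subst ((L.lhomWithConstants N).onFormula φ)
    (Sum.elim Term.var fun j => (L.con (c j)).term)

theorem realize_instanceFormula {N : Type w} {K : Type*} [L.Structure K] [L[[N]].Structure K]
    [(L.lhomWithConstants N).IsExpansionOn K] (φ : L.Formula (Fin m ⊕ Fin n)) (c : Fin n → N)
    (a : Fin m → K) :
    (instanceFormula φ c).Realize a ↔ φ.Realize (Sum.elim a fun j => (L.con (c j) : K)) := by
  rw [Formula.Realize, instanceFormula, BoundedFormula.realize_subst]
  refine ((L.lhomWithConstants N).realize_onFormula φ).trans (iff_of_eq (congrArg _ ?_))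
  funext i
  rcases i with i | j
  · rfl
  · exact Term.realize_constants

theorem instancesConsistent_of_finite {N : Type w} [L.Structure N] [Nonempty N]
    (φ : L.Formula (Fin m ⊕ Fin n)) (C : Set (Fin n → N))
    (h : ∀ D : Finset (Fin n → N), (D : Set (Fin n → N)) ⊆ C →
      ∃ a : Fin m → N, ∀ c ∈ D, φ.Realize (Sum.elim a c)) :
    InstancesConsistent φ C := by
  classical
  let T₀ : L[[N]][[Fin m]].Theory :=
    (L[[N]].lhomWithConstants (Fin m)).onTheory (L.elementaryDiagram N)
  -- New constants name the solution; `none` carries the elementary diagram and `some c` one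
  -- instance. Any finite part is satisfied in `N` itself.
  let T : Option C → L[[N]][[Fin m]].Theory := fun o =>
    o.elim T₀ fun c => {Formula.equivSentence (instanceFormula φ c.1)}
  have hsat : Theory.IsSatisfiable (⋃ o, T o) := by
    rw [Theory.isSatisfiable_iUnion_iff_isSatisfiable_iUnion_finset]
    intro s
    obtain ⟨a, ha⟩ := h (s.eraseNone.image Subtype.val) (by
      intro c hc
      obtain ⟨d, -, rfl⟩ := Finset.mem_image.1 (Finset.mem_coe.1 hc)
      exact d.2)
    let _ := constantsOn.structure a
    have : N ⊨ (⋃ o ∈ s, T o : L[[N]][[Fin m]].Theory) := by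
      refine ⟨fun σ hσ => ?_⟩
      simp only [Set.mem_iUnion] at hσ
      obtain ⟨o, ho, hσ⟩ := hσ
      cases o with
      | none =>
        have h0 : N ⊨ T₀ := (LHom.onTheory_model _ _).2 inferInstance
        exact h0.realize_of_mem σ hσ
      | some c =>
        obtain rfl : σ = Formula.equivSentence (instanceFormula φ c.1) := hσ
        have := ha c.1 (Finset.mem_image_of_mem _ (Finset.mem_eraseNone.2 ho))
        rw [Formula.realize_equivSentence]
        exact (realize_instanceFormula φ c.1 _).2 this
    exact Theory.Model.isSatisfiable N
  obtain ⟨K⟩ := hsat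
  let i1 : L[[N]].Structure K := (L[[N]].lhomWithConstants (Fin m)).reduct K
  let i2 : L.Structure K := (L.lhomWithConstants N).reduct K
  have e1 : (L[[N]].lhomWithConstants (Fin m)).IsExpansionOn K := LHom.isExpansionOn_reduct _ _
  have e2 : (L.lhomWithConstants N).IsExpansionOn K := LHom.isExpansionOn_reduct _ _
  have hK0 : K ⊨ T₀ := K.is_model.mono (Set.subset_iUnion T none)
  have hK1 : K ⊨ L.elementaryDiagram N := (LHom.onTheory_model _ _).1 hK0
  refine ⟨K, i2, ElementaryEmbedding.ofModelsElementaryDiagram L N K,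
    fun i => (L[[N]].con i : K), fun c hc => ?_⟩
  have hc' : K ⊨ Formula.equivSentence (instanceFormula φ c) :=
    K.is_model.realize_of_mem _ (Set.mem_iUnion.2 ⟨some ⟨c, hc⟩, rfl⟩)
  rw [Formula.realize_equivSentence] at hc'
  exact (realize_instanceFormula φ c _).1 hc'

end Transfer

-- The non-finite cover property of the reduct.

section Main

variable {L : Language.{u, v}} {M : Type w} [L.Structure M] [Nonempty M]

theorem IsMAReduct.isMACombination {L' : Language.{u', v'}} [L'.Structure M]
    (h : IsMAReduct L M L') {m n : ℕ} (φ : L'.Formula (Fin m ⊕ Fin n)) :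
    IsMACombination L {a : Fin m ⊕ Fin n → M | φ.Realize a} := by
  have h1 := exists_isMAStar_iff.1 ((h (m + n) {a | (φ.relabel finSumFinEquiv).Realize a}).1
    (Set.empty_definable_iff.2 ⟨_, rfl⟩))
  convert h1.preimage_comp finSumFinEquiv.symm using 1
  ext a
  simp [Formula.realize_relabel, Function.comp_assoc]

theorem IsMAReduct.hasNFCP {L' : Language.{u', v'}} [L'.Structure M]
    (h : IsMAReduct L M L') : Theory.HasNFCP.{u', v', w'} (L'.completeTheory M) := by
  classical
  intro m n φ
  obtain ⟨k, hk⟩ := (h.isMACombination φ).exists_helly m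
  refine ⟨k, fun N _ _ C hC => ?_⟩
  -- The same `k` serves every family size `s`, so this scheme of sentences gives one bound for all
  -- models of the theory.
  have hM : ∀ s, M ⊨ hellySentence φ k s := by
    intro s
    rw [realize_hellySentence]
    intro c hc
    obtain ⟨a, ha⟩ := hk (Finset.univ.image c) (by
      intro D hD hDcard
      choose g hg using fun d : D => Finset.mem_image.1 (hD d.2)
      obtain ⟨a, ha⟩ := hc (Finset.univ.image g)
        (Finset.card_image_le.trans (by simpa using hDcard))
      refine ⟨a, fun d hd => ?_⟩
      have := ha (g ⟨d, hd⟩) (Finset.mem_image_of_mem _ (Finset.mem_univ _))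
      rwa [(hg ⟨d, hd⟩).2] at this)
    exact ⟨a, fun t => ha _ (Finset.mem_image_of_mem _ (Finset.mem_univ t))⟩
  have hMN : M ≅[L'] N := 
    elementarilyEquivalent_iff.2 fun σ => (realize_iff_of_model_completeTheory M N σ).symm
  have : Nonempty N := hMN.nonempty
  refine instancesConsistent_of_finite φ C fun D hD => ?_
  have hN := (realize_hellySentence φ k D.card).1 ((hMN.realize_sentence _).1 (hM D.card))
    fun t => (D.equivFin.symm t).1
  obtain ⟨a, ha⟩ := hN (by
    intro D' hD'
    obtain ⟨N', _, f, a, ha⟩ := hC (D'.image fun t => (D.equivFin.symm t).1) (by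
      intro c hc
      obtain ⟨t, -, rfl⟩ := Finset.mem_image.1 (Finset.mem_coe.1 hc)
      exact hD (D.equivFin.symm t).2) (Finset.card_image_le.trans hD')
    -- Consistency only gives a solution in an elementary extension; solvability of finitely many
    -- instances is first-order, so it descends to `N`.
    refine (realize_existsInstances φ D' fun p => (D.equivFin.symm p.1).1 p.2).1 ?_
    rw [← f.map_formula, realize_existsInstances]
    exact ⟨a, fun t ht => ha _ (Finset.mem_coe.2 (Finset.mem_image_of_mem _ ht))⟩)
  refine ⟨a, fun c hc => ?_⟩
  simpa using ha (D.equivFin ⟨c, hc⟩)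

end Main

end FirstOrder.Language

theorem proposition2p12 (L : FirstOrder.Language.{u, v}) (M : Type w) [L.Structure M] [Nonempty M] :
    IsMAReduct L M (maLanguage L M) ∧
      ∀ (L' : FirstOrder.Language.{u', v'}) [L'.Structure M], IsMAReduct L M L' →
        Theory.HasNFCP.{u', v', w'} (L'.completeTheory M) :=
  ⟨isMAReduct_maLanguage, fun _ _ h => h.hasNFCP⟩
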